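/- Let $\mathcal{X}$ be a set of size $N$. Let $Q$ be the uniform distribution over the bijections $X=(X_1,\dots,X_N)$ from $[N]=\{1,\dots,N\}$ to $\mathcal{X}$, and let $P$ be any probability distribution over such bijections. Let $f_1,\dots,f_m:\mathcal{X}^N\to[0,1]$ be a read-$k$ family of functions, that is, for each $1\le i\le N$ at most $k$ of the functions $f_1,\dots,f_m$ depend on the $i$-th coordinate. Put $p=\frac1m\sum_{j=1}^m \mathbb{E}_{P}[f_j(X)]$ and $q=\frac1m\sum_{j=1}^m \mathbb{E}_{Q}[f_j(X)]$. Then $$2k\cdot \mathrm{KL}(P\,\|\,Q)\ \ge\ m\cdot \mathrm{KL}(p\,\|\,q),$$ where $\mathrm{KL}(P\|Q)=\sum_{\sigma:\,P(\sigma)>0}P(\sigma)\log\frac{P(\sigma)}{Q(\sigma)}$ is the Kullback–Leibler divergence (with natural logarithm), and $\mathrm{KL}(p\|q)=p\log\frac{p}{q}+(1-p)\log\frac{1-p}{1-q}$ is the Kullback–Leibler divergence between the Bernoulli distributions with parameters $p$ and $q$, which is finite here (a summand with coefficient $0$ is read as $0$). -/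

import Mathlib

open scoped ENNReal BigOperators

namespace ReadKBijections

/-- `f` depends on the coordinate `i`: changing the `i`-th coordinate alone can change the value. -/
def DependsOnCoord {ι X β : Type*} (f : (ι → X) → β) (i : ι) : Prop :=
  ∃ x y : ι → X, (∀ l, l ≠ i → x l = y l) ∧ f x ≠ f y

/-- A family `f_1, …, f_m` of functions on the product space `X ^ ι` is read-`k` if for each
coordinate `i` at most `k` of the functions depend on the `i`-th coordinate. -/
def IsReadK {ι X β : Type*} {m : ℕ} (k : ℕ) (f : Fin m → (ι → X) → β) : Prop :=
  ∀ i : ι, {j : Fin m | DependsOnCoord (f j) i}.ncard ≤ k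

theorem nonempty_bijections {N : ℕ} {X : Type*} [Fintype X] (hX : Fintype.card X = N) :
    Nonempty (Fin N ≃ X) :=
  ⟨(Fintype.equivFinOfCardEq hX).symm⟩

/-- The uniform distribution over the bijections from `[N]` to a set `X` of size `N`. -/
noncomputable def uniformBijection {N : ℕ} {X : Type*} [Fintype X] [DecidableEq X]
    (hX : Fintype.card X = N) : PMF (Fin N ≃ X) :=
  haveI : Nonempty (Fin N ≃ X) := nonempty_bijections hX
  PMF.uniformOfFintype (Fin N ≃ X)

/-- Kullback-Leibler divergence (natural logarithm, value `∞` if the support of `P` is not contained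
in that of `Q`) of two discrete distributions; every set is measurable. -/
noncomputable def KL {α : Type*} (P Q : PMF α) : ℝ≥0∞ :=
  letI : MeasurableSpace α := ⊤
  InformationTheory.klDiv P.toMeasure Q.toMeasure

/-- Kullback-Leibler divergence between the Bernoulli distributions with parameters `p`, `q`. -/
noncomputable def KLBernoulli (p q : unitInterval) : ℝ≥0∞ :=
  InformationTheory.klDiv (ProbabilityTheory.bernoulliMeasure true false p)
    (ProbabilityTheory.bernoulliMeasure true false q)

/-- The expectation of `g (X)` when the bijection `X = (X_1, …, X_N)` is drawn from `P`. -/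
noncomputable def expect {N : ℕ} {X : Type*} [Fintype X] [DecidableEq X]
    (P : PMF (Fin N ≃ X)) (g : (Fin N → X) → unitInterval) : ℝ :=
  ∑ σ : Fin N ≃ X, (P σ).toReal * (g (fun i => σ i) : ℝ)

theorem sum_toReal_pmf {α : Type*} [Fintype α] (P : PMF α) : ∑ a, (P a).toReal = 1 := by
  rw [← ENNReal.toReal_sum (fun a _ => P.apply_ne_top a), ← tsum_fintype (L := .unconditional _),
    P.tsum_coe, ENNReal.toReal_one]

theorem expect_mem {N : ℕ} {X : Type*} [Fintype X] [DecidableEq X]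
    (P : PMF (Fin N ≃ X)) (g : (Fin N → X) → unitInterval) :
    expect P g ∈ Set.Icc (0 : ℝ) 1 := by
  constructor
  · exact Finset.sum_nonneg fun σ _ => mul_nonneg ENNReal.toReal_nonneg (g _).2.1
  · rw [← sum_toReal_pmf P]
    exact Finset.sum_le_sum fun σ _ =>
      mul_le_of_le_one_right ENNReal.toReal_nonneg (g _).2.2

theorem average_mem {m : ℕ} (a : Fin m → ℝ) (ha : ∀ j, a j ∈ Set.Icc (0 : ℝ) 1) :
    (1 / (m : ℝ)) * ∑ j, a j ∈ Set.Icc (0 : ℝ) 1 := by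
  constructor
  · exact mul_nonneg (by positivity) (Finset.sum_nonneg fun j _ => (ha j).1)
  · have h : ∑ j, a j ≤ (m : ℝ) := by
      simpa using Finset.sum_le_sum (s := Finset.univ) fun j _ => (ha j).2
    rw [one_div_mul_eq_div]
    exact div_le_one_of_le₀ h (Nat.cast_nonneg m)

/-- The average `(1 / m) * ∑ j, E_P [f_j (X)]` of the expectations, as a point of `[0, 1]`. -/
noncomputable def avgExpect {N m : ℕ} {X : Type*} [Fintype X] [DecidableEq X]
    (P : PMF (Fin N ≃ X)) (f : Fin m → (Fin N → X) → unitInterval) : unitInterval :=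
  ⟨(1 / (m : ℝ)) * ∑ j, expect P (f j), average_mem _ fun j => expect_mem P (f j)⟩

end ReadKBijections

/-! Fix a bijection to identify the sample space with the symmetric group, and let `F` be the
density of `P` with respect to `Q`. If `H j` fixes pointwise the coordinates that `f j` reads, then
`f j` is constant on left cosets of `H j`, so its mean only sees the coset average of `F`. The
log-sum inequality with weights `f j` and `1 - f j` bounds `m * KL(p‖q)` by the sum of the entropies
of these averages, up to normalisation.

It remains to prove a Shearer inequality: these entropies add up to at most `2 * k` times the
entropy of `F` (`sum_sumMulLog_cosetAverage_le`). Run the random transposition walk. A tangent plane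
bound for `(a - b) * (log a - log b)` shows that the entropy production of the `H j`-average is at
most that of `F` from steps outside `H j` (`dirichlet_cosetAverage_le`). A transposition lies
outside `H j` only if it moves a coordinate that `f j` reads; it moves two, whence the factor `2 *
k`. Thus, with any slack in the constant, a minimiser of the entropy deficit has zero entropy
production, so it is constant and the minimum is `0`. -/

namespace ReadKBijections

/-! ### Entropy and elementary logarithmic inequalities -/

/-- The unnormalised entropy functional `∑ F log F`. -/
noncomputable def sumMulLog {α : Type*} [Fintype α] (F : α → ℝ) : ℝ := ∑ g, F g * Real.log (F g)

theorem continuous_sumMulLog {α : Type*} [Fintype α] : Continuous (sumMulLog : (α → ℝ) → ℝ) :=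
  continuous_finsetSum _ fun g _ => Real.continuous_mul_log.comp (continuous_apply g)

/-- The derivative of `x * log x` is `log x + 1`; the `1` drops out along a mass-preserving
direction. -/
theorem hasDerivAt_sumMulLog {α : Type*} [Fintype α] {F : α → ℝ} (hF : ∀ g, 0 < F g) {D : α → ℝ}
    (hD : ∑ g, D g = 0) :
    HasDerivAt (fun t : ℝ => sumMulLog fun g => F g + t * D g)
      (∑ g, Real.log (F g) * D g) 0 := by
  have h : HasDerivAt (fun t : ℝ => ∑ g, (F g + t * D g) * Real.log (F g + t * D g))
      (∑ g, (Real.log (F g) + 1) * D g) 0 := by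
    refine HasDerivAt.fun_sum fun g _ => ?_
    have h1 : HasDerivAt (fun t : ℝ => F g + t * D g) (D g) 0 := by
      simpa using ((hasDerivAt_id (0 : ℝ)).mul_const (D g)).const_add (F g)
    have h2 := Real.hasDerivAt_mul_log (hF g).ne'
    have h3 : HasDerivAt (fun x : ℝ => x * Real.log x) (Real.log (F g) + 1) (F g + 0 * D g) := by
      simpa using h2
    exact h3.comp (0 : ℝ) h1
  have h4 : ∑ g, (Real.log (F g) + 1) * D g = ∑ g, Real.log (F g) * D g := by
    simp only [add_mul, Finset.sum_add_distrib, one_mul, hD, add_zero]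
  rwa [h4] at h

theorem log_sub_mul_sub_nonneg {a b : ℝ} (ha : 0 < a) (hb : 0 < b) :
    0 ≤ (Real.log a - Real.log b) * (a - b) := by
  rcases le_total b a with h | h
  · exact mul_nonneg (sub_nonneg.2 (Real.log_le_log hb h)) (sub_nonneg.2 h)
  · exact mul_nonneg_of_nonpos_of_nonpos (sub_nonpos.2 (Real.log_le_log ha h)) (sub_nonpos.2 h)

/-- Tangent plane inequality for the jointly convex function `(a - b) * (log a - log b)`. -/
theorem tangent_le_sub_mul_log_sub {a b x y : ℝ} (ha : 0 < a) (hb : 0 < b) (hx : 0 < x)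
    (hy : 0 < y) :
    (Real.log x - Real.log y) * (a - b) + (a * (1 - y / x) + b * (1 - x / y))
      ≤ (Real.log a - Real.log b) * (a - b) := by
  have h1 := Real.log_le_sub_one_of_pos (show 0 < b * x / (a * y) by positivity)
  have h2 := Real.log_le_sub_one_of_pos (show 0 < a * y / (b * x) by positivity)
  rw [Real.log_div (by positivity) (by positivity), Real.log_mul (by positivity) (by positivity),
    Real.log_mul (by positivity) (by positivity)] at h1 h2
  have h3 := mul_le_mul_of_nonneg_left h1 ha.le
  have h4 := mul_le_mul_of_nonneg_left h2 hb.le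
  have h5 : a * (b * x / (a * y) - 1) = b * (x / y) - a := by field_simp
  have h6 : b * (a * y / (b * x) - 1) = a * (y / x) - b := by field_simp
  rw [h5] at h3
  rw [h6] at h4
  linarith

/-! ### Random walks, coset averages and entropy on a finite group -/

section GroupEntropy

variable {G : Type*} [Group G]

/-- The generator of the random walk with steps in `C`. -/
def walkGenerator (C : Finset G) (F : G → ℝ) (g : G) : ℝ := ∑ c ∈ C, (F (g * c) - F g)

/-- Since `h * c = (h * c * h⁻¹) * h`, moving `h` past a step only permutes the
conjugation-invariant set `C`. -/
theorem walkGenerator_mul_right {C : Finset G} (hC : ∀ g, ∀ c ∈ C, g * c * g⁻¹ ∈ C)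
    (H : Subgroup G) {F : G → ℝ} (hF : ∀ g, ∀ h ∈ H, F (g * h) = F g) (g : G) {h : G}
    (hh : h ∈ H) : walkGenerator C F (g * h) = walkGenerator C F g := by
  refine Finset.sum_bij' (fun c _ => h * c * h⁻¹) (fun c _ => h⁻¹ * c * h)
    (fun c hc => hC h c hc) (fun c hc => by simpa using hC h⁻¹ c hc)
    (fun c _ => by group) (fun c _ => by group) fun c _ => ?_
  rw [hF g h hh, ← hF (g * (h * c * h⁻¹)) h hh]
  congr 2
  group

variable [Fintype G]

/-- The average of `F` over the left coset `g H`. -/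
noncomputable def cosetAverage (H : Subgroup G) (F : G → ℝ) (g : G) : ℝ :=
  (Nat.card H : ℝ)⁻¹ * ∑ᶠ h : H, F (g * h)

open Classical in
theorem cosetAverage_eq_sum (H : Subgroup G) (F : G → ℝ) (g : G) :
    cosetAverage H F g = (Nat.card H : ℝ)⁻¹ * ∑ h : H, F (g * h) := by
  rw [cosetAverage, finsum_eq_sum_of_fintype]

theorem card_mul_inv_card (H : Subgroup G) : (Nat.card H : ℝ)⁻¹ * (Nat.card H : ℝ) = 1 :=
  inv_mul_cancel₀ (by exact_mod_cast Nat.card_pos.ne')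

theorem cosetAverage_add_smul (H : Subgroup G) (F D : G → ℝ) (t : ℝ) (g : G) :
    cosetAverage H (fun x => F x + t * D x) g
      = cosetAverage H F g + t * cosetAverage H D g := by
  classical
  simp only [cosetAverage_eq_sum, Finset.sum_add_distrib, ← Finset.mul_sum]
  ring

theorem cosetAverage_const (H : Subgroup G) (c : ℝ) (g : G) :
    cosetAverage H (fun _ => c) g = c := by
  classical
  rw [cosetAverage_eq_sum, Finset.sum_const, Finset.card_univ, ← Nat.card_eq_fintype_card,
    nsmul_eq_mul, ← mul_assoc, card_mul_inv_card, one_mul]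

theorem le_cosetAverage (H : Subgroup G) {F : G → ℝ} {d : ℝ} (hF : ∀ g, d ≤ F g) (g : G) :
    d ≤ cosetAverage H F g := by
  classical
  rw [← cosetAverage_const H d g, cosetAverage_eq_sum, cosetAverage_eq_sum]
  gcongr
  exact hF _

theorem cosetAverage_pos (H : Subgroup G) {F : G → ℝ} (hF : ∀ g, 0 < F g) (g : G) :
    0 < cosetAverage H F g := by
  classical
  rw [cosetAverage_eq_sum]
  exact mul_pos (inv_pos.2 (by exact_mod_cast Nat.card_pos))
    (Finset.sum_pos (fun _ _ => hF _) ⟨1, Finset.mem_univ _⟩)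

theorem cosetAverage_mul_right (H : Subgroup G) (F : G → ℝ) (g : G) {h : G} (hh : h ∈ H) :
    cosetAverage H F (g * h) = cosetAverage H F g := by
  classical
  rw [cosetAverage_eq_sum, cosetAverage_eq_sum]
  congr 1
  refine Fintype.sum_equiv (Equiv.mulLeft (⟨h, hh⟩ : H)) _ _ fun x => ?_
  simp [mul_assoc]

/-- The defining property of a conditional expectation: translation by `h` preserves both the
counting measure and `w`. -/
theorem sum_cosetAverage_mul (H : Subgroup G) (F w : G → ℝ)
    (hw : ∀ g, ∀ h ∈ H, w (g * h) = w g) :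
    ∑ g, cosetAverage H F g * w g = ∑ g, F g * w g := by
  classical
  have key : ∀ h : H, ∑ g, F (g * h) * w g = ∑ g, F g * w g := fun h =>
    Fintype.sum_equiv (Equiv.mulRight (h : G)) _ _ fun g => by simp [hw g h h.2]
  calc ∑ g, cosetAverage H F g * w g
      = (Nat.card H : ℝ)⁻¹ * ∑ h : H, ∑ g, F (g * h) * w g := by
        rw [Finset.sum_comm, Finset.mul_sum]
        refine Finset.sum_congr rfl fun g _ => ?_
        rw [cosetAverage_eq_sum, mul_assoc, Finset.sum_mul]
    _ = ∑ g, F g * w g := by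
        simp only [key]
        rw [Finset.sum_const, Finset.card_univ, ← Nat.card_eq_fintype_card,
          nsmul_eq_mul, ← mul_assoc, card_mul_inv_card, one_mul]

theorem sum_cosetAverage (H : Subgroup G) (F : G → ℝ) :
    ∑ g, cosetAverage H F g = ∑ g, F g := by
  simpa using sum_cosetAverage_mul H F (fun _ => 1) (fun _ _ _ => rfl)

theorem sum_mul_right (F : G → ℝ) (c : G) : ∑ g, F (g * c) = ∑ g, F g :=
  Fintype.sum_equiv (Equiv.mulRight c) _ _ fun _ => rfl

theorem sum_walkGenerator (C : Finset G) (F : G → ℝ) : ∑ g, walkGenerator C F g = 0 := by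
  simp only [walkGenerator]
  rw [Finset.sum_comm]
  refine Finset.sum_eq_zero fun c _ => ?_
  rw [Finset.sum_sub_distrib, sum_mul_right, sub_self]

/-- Summation by parts for the generator of a symmetric random walk. -/
theorem sum_mul_walkGenerator {C : Finset G} (hC : ∀ c ∈ C, c⁻¹ ∈ C) (u F : G → ℝ) :
    2 * ∑ g, u g * walkGenerator C F g
      = -∑ c ∈ C, ∑ g, (u (g * c) - u g) * (F (g * c) - F g) := by
  have h1 : ∑ g, u g * walkGenerator C F g = ∑ c ∈ C, ∑ g, u g * (F (g * c) - F g) := by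
    rw [Finset.sum_comm]
    exact Finset.sum_congr rfl fun g _ => by rw [walkGenerator, Finset.mul_sum]
  have h2 : ∑ c ∈ C, ∑ g, u g * (F (g * c) - F g)
      = ∑ c ∈ C, ∑ g, u (g * c) * (F g - F (g * c)) := by
    refine Finset.sum_bij' (fun c _ => c⁻¹) (fun c _ => c⁻¹) hC hC (by simp) (by simp)
      fun c _ => ?_
    rw [← sum_mul_right _ c⁻¹]
    simp
  have h3 : 2 * ∑ g, u g * walkGenerator C F g = ∑ c ∈ C, ∑ g, u g * (F (g * c) - F g)
      + ∑ c ∈ C, ∑ g, u (g * c) * (F g - F (g * c)) := by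
    rw [← h2, ← h1]; ring
  rw [h3, ← Finset.sum_add_distrib, ← Finset.sum_neg_distrib]
  refine Finset.sum_congr rfl fun c _ => ?_
  rw [← Finset.sum_add_distrib, ← Finset.sum_neg_distrib]
  exact Finset.sum_congr rfl fun g _ => by ring

/-- The Dirichlet form along the averages over cosets of `H` only sees the steps outside `H`. -/
theorem dirichlet_cosetAverage_le {C : Finset G} (hC : ∀ g, ∀ c ∈ C, g * c * g⁻¹ ∈ C)
    (hC' : ∀ c ∈ C, c⁻¹ ∈ C) (H : Subgroup G) [DecidablePred (· ∈ H)] {F : G → ℝ}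
    (hF : ∀ g, 0 < F g) :
    ∑ c ∈ C, ∑ g, (Real.log (cosetAverage H F (g * c)) - Real.log (cosetAverage H F g))
        * (F (g * c) - F g)
      ≤ ∑ c ∈ C with c ∉ H, ∑ g, (Real.log (F (g * c)) - Real.log (F g)) * (F (g * c) - F g) := by
  set A := cosetAverage H F with hA
  have hinv : ∀ g, ∀ h ∈ H, A (g * h) = A g := fun g h hh => cosetAverage_mul_right H F g hh
  have hpos : ∀ g, 0 < A g := cosetAverage_pos H hF
  -- The correction term of the tangent plane at `(A (g * c), A g)`.
  set R : G → G → ℝ := fun c g => F (g * c) * (1 - A g / A (g * c)) + F g * (1 - A (g * c) / A g)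
  have hflip : ∑ c ∈ C, ∑ g, F (g * c) * (1 - A g / A (g * c))
      = ∑ c ∈ C, ∑ g, F g * (1 - A (g * c) / A g) := by
    refine Finset.sum_bij' (fun c _ => c⁻¹) (fun c _ => c⁻¹) hC' hC' (by simp) (by simp)
      fun c _ => ?_
    rw [← sum_mul_right _ c⁻¹]
    simp
  have hgen : ∑ c ∈ C, ∑ g, F g * (1 - A (g * c) / A g) = 0 := by
    have h1 : ∑ c ∈ C, ∑ g, F g * (1 - A (g * c) / A g)
        = -∑ g, F g * (walkGenerator C A g / A g) := by
      rw [Finset.sum_comm, ← Finset.sum_neg_distrib]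
      refine Finset.sum_congr rfl fun g _ => ?_
      rw [walkGenerator, Finset.sum_div, Finset.mul_sum, ← Finset.sum_neg_distrib]
      refine Finset.sum_congr rfl fun c _ => ?_
      have := (hpos g).ne'
      field_simp
      ring
    -- The quotient of the generator by `A` is `H`-invariant, so `F` may be replaced by `A`, which
    -- cancels the denominator.
    rw [h1, ← sum_cosetAverage_mul H F (fun g => walkGenerator C A g / A g), neg_eq_zero,
      ← sum_walkGenerator C A]
    · exact Finset.sum_congr rfl fun g _ => mul_div_cancel₀ _ (hpos g).ne'
    · intro g h hh
      simp only [hinv g h hh, walkGenerator_mul_right hC H hinv g hh]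
  -- Steps in `H` contribute nothing to the correction, so the sum extends to all of `C`, where it
  -- vanishes.
  have hR : ∑ c ∈ C with c ∉ H, ∑ g, R c g = 0 := by
    rw [Finset.sum_filter_of_ne]
    · simp only [R, Finset.sum_add_distrib]
      rw [hflip, hgen, add_zero]
    · intro c _ hne hc
      refine hne (Finset.sum_eq_zero fun g _ => ?_)
      simp [R, hinv g c hc, (hpos g).ne']
  have hL : ∑ c ∈ C, ∑ g, (Real.log (A (g * c)) - Real.log (A g)) * (F (g * c) - F g)
      = ∑ c ∈ C with c ∉ H, ∑ g,
        (Real.log (A (g * c)) - Real.log (A g)) * (F (g * c) - F g) := by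
    rw [Finset.sum_filter_of_ne]
    intro c _ hne hc
    refine hne (Finset.sum_eq_zero fun g _ => ?_)
    rw [hinv g c hc, sub_self, zero_mul]
  rw [hL, ← add_zero (∑ c ∈ C with c ∉ H, _), ← hR, ← Finset.sum_add_distrib]
  refine Finset.sum_le_sum fun c _ => ?_
  rw [← Finset.sum_add_distrib]
  exact Finset.sum_le_sum fun g _ => tangent_le_sub_mul_log_sub (hF _) (hF _) (hpos _) (hpos _)

theorem continuous_cosetAverage (H : Subgroup G) :
    Continuous (cosetAverage H : (G → ℝ) → G → ℝ) := by
  classical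
  refine continuous_pi fun g => ?_
  simp only [cosetAverage_eq_sum]
  fun_prop

/-- All summands are nonnegative, hence zero; injectivity of `log` makes `F` invariant under each
step, and the steps generate `G`. -/
theorem eq_const_of_dirichlet_eq_zero {C : Finset G}
    (hgen : Subgroup.closure (C : Set G) = ⊤) {F : G → ℝ} (hF : ∀ g, 0 < F g)
    (h0 : ∑ c ∈ C, ∑ g, (Real.log (F (g * c)) - Real.log (F g)) * (F (g * c) - F g) ≤ 0)
    (g : G) : F g = F 1 := by
  have hnn : ∀ c g, 0 ≤ (Real.log (F (g * c)) - Real.log (F g)) * (F (g * c) - F g) :=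
    fun c g => log_sub_mul_sub_nonneg (hF _) (hF _)
  have hstep : ∀ c ∈ C, ∀ g, F (g * c) = F g := by
    intro c hc g
    have h1 := (Finset.sum_eq_zero_iff_of_nonneg
      (fun c _ => Finset.sum_nonneg fun g _ => hnn c g)).1
      (le_antisymm h0 (Finset.sum_nonneg fun c _ => Finset.sum_nonneg fun g _ => hnn c g)) c hc
    have h2 := (Finset.sum_eq_zero_iff_of_nonneg (fun g _ => hnn c g)).1 h1 g (Finset.mem_univ g)
    rcases mul_eq_zero.1 h2 with h | h
    · exact Real.log_injOn_pos (hF _) (hF _) (sub_eq_zero.1 h)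
    · exact sub_eq_zero.1 h
  have hall : ∀ x ∈ Subgroup.closure (C : Set G), ∀ g, F (g * x) = F g := by
    intro x hx
    induction hx using Subgroup.closure_induction with
    | mem x hx => exact hstep x hx
    | one => simp
    | mul x y _ _ hx hy => intro g; rw [← mul_assoc, hy, hx]
    | inv x _ hx => intro g; simpa using (hx (g * x⁻¹)).symm
  simpa using hall g (hgen ▸ Subgroup.mem_top g) 1

/-- The proof minimises the difference of the two sides over the densities bounded below by `d`:
at the minimiser, the derivative in the direction of the walk generator forces constancy. -/
theorem sum_sumMulLog_cosetAverage_le_of_le {ι : Type*} [Fintype ι] {C : Finset G}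
    (hC : ∀ g, ∀ c ∈ C, g * c * g⁻¹ ∈ C) (hC' : ∀ c ∈ C, c⁻¹ ∈ C)
    (hgen : Subgroup.closure (C : Set G) = ⊤) (H : ι → Subgroup G) (K : ℕ)
    (hK : ∀ c ∈ C, {j | c ∉ H j}.ncard ≤ K) {d e : ℝ} (hd : 0 < d) (he : 0 < e)
    {F : G → ℝ} (hF : ∀ g, d ≤ F g) (hsum : ∑ g, F g = Fintype.card G) :
    ∑ j, sumMulLog (cosetAverage (H j) F) ≤ (K + e) * sumMulLog F := by
  classical
  set Φ : (G → ℝ) → ℝ := fun F => (K + e) * sumMulLog F - ∑ j, sumMulLog (cosetAverage (H j) F)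
    with hΦ
  have hΦc : Continuous Φ := (continuous_const.mul continuous_sumMulLog).sub
    (continuous_finsetSum _ fun j _ => continuous_sumMulLog.comp (continuous_cosetAverage (H j)))
  set S : Set (G → ℝ) := {F | (∀ g, d ≤ F g) ∧ ∑ g, F g = Fintype.card G} with hS
  have hScompact : IsCompact S := by
    refine (isCompact_univ_pi fun _ : G =>
      isCompact_Icc (a := d) (b := (Fintype.card G : ℝ))).of_isClosed_subset ?_ ?_
    · have h1 : IsClosed {F : G → ℝ | ∀ g, d ≤ F g} := by
        simp only [Set.ofPred_forall]
        exact isClosed_iInter fun g => isClosed_le continuous_const (continuous_apply g)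
      exact h1.inter (isClosed_eq (by fun_prop) continuous_const)
    · intro F hF g _
      refine ⟨hF.1 g, ?_⟩
      rw [← hF.2]
      exact Finset.single_le_sum (fun i _ => hd.le.trans (hF.1 i)) (Finset.mem_univ g)
  obtain ⟨M, hM, hmin⟩ := hScompact.exists_isMinOn ⟨F, hF, hsum⟩ hΦc.continuousOn
  have hMpos : ∀ g, 0 < M g := fun g => hd.trans_le (hM.1 g)
  have hApos : ∀ j g, 0 < cosetAverage (H j) M g := fun j g =>
    hd.trans_le (le_cosetAverage (H j) hM.1 g)
  set D := walkGenerator C M with hDdef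
  set E := fun (u : G → ℝ) (c : G) => ∑ g, (u (g * c) - u g) * (M (g * c) - M g) with hE
  have hDsum : ∑ g, D g = 0 := sum_walkGenerator C M
  set V := (K + e) * ∑ g, Real.log (M g) * D g
      - ∑ j, ∑ g, Real.log (cosetAverage (H j) M g) * D g with hV
  have hderiv : HasDerivAt (fun t : ℝ => Φ fun g => M g + t * D g) V 0 := by
    refine HasDerivAt.sub ((hasDerivAt_sumMulLog hMpos hDsum).const_mul _)
      (HasDerivAt.fun_sum fun j _ => ?_)
    have h1 := hasDerivAt_sumMulLog (hApos j) ((sum_cosetAverage (H j) D).trans hDsum)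
    -- The logarithm of the average is `H j`-invariant, so the averaged direction may be replaced by
    -- `D` itself.
    have h2 : ∑ g, Real.log (cosetAverage (H j) M g) * cosetAverage (H j) D g
        = ∑ g, Real.log (cosetAverage (H j) M g) * D g := by
      simp only [mul_comm (Real.log _)]
      exact sum_cosetAverage_mul (H j) D _ fun g h hh => by
        rw [cosetAverage_mul_right (H j) M g hh]
    rw [h2] at h1
    have h3 : ∀ t, (cosetAverage (H j) fun g => M g + t * D g)
        = fun g => cosetAverage (H j) M g + t * cosetAverage (H j) D g := fun t =>
      funext (cosetAverage_add_smul _ _ _ _)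
    simpa only [h3] using h1
  -- For such `t`, `M + t * D` is a convex combination of `M` and its translates, so it keeps the
  -- lower bound `d`.
  have hmem : ∀ t : ℝ, 0 ≤ t → t * C.card ≤ 1 → (fun g => M g + t * D g) ∈ S := by
    intro t ht ht1
    refine ⟨fun g => ?_, ?_⟩
    · have h1 : D g ≥ C.card * (d - M g) := by
        rw [hDdef, walkGenerator, ← nsmul_eq_mul]
        exact Finset.card_nsmul_le_sum _ _ _ fun c _ => sub_le_sub_right (hM.1 _) _
      nlinarith [mul_le_mul_of_nonneg_left h1 ht, hM.1 g]
    · rw [Finset.sum_add_distrib, ← Finset.mul_sum, hDsum, mul_zero, add_zero, hM.2]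
  have hVnn : 0 ≤ V := by
    by_contra! hneg
    have h1 := hderiv.hasDerivWithinAt (s := Set.Ioi 0)
    rw [hasDerivWithinAt_iff_tendsto_slope' (by simp)] at h1
    have h2 := h1.eventually (gt_mem_nhds hneg)
    have h3 : ∀ᶠ t : ℝ in nhdsWithin 0 (Set.Ioi 0), t * C.card < 1 :=
      nhdsWithin_le_nhds ((continuous_id.mul continuous_const).tendsto' 0 0 (by simp)
        |>.eventually (gt_mem_nhds one_pos))
    obtain ⟨t, ⟨ht2, ht3⟩, ht : 0 < t⟩ := ((h2.and h3).and self_mem_nhdsWithin).exists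
    have h4 := hmin (hmem t ht.le ht3.le)
    have h5 : Φ M ≤ Φ fun g => M g + t * D g := h4
    rw [slope_def_field, sub_zero] at ht2
    have h6 : (Φ fun g => M g + 0 * D g) = Φ M := by simp
    rw [h6] at ht2
    exact absurd ht2 (not_lt.2 (div_nonneg (sub_nonneg.2 h5) ht.le))
  have hparts : ∀ u : G → ℝ, 2 * ∑ g, u g * D g = -∑ c ∈ C, E u c := fun u =>
    sum_mul_walkGenerator hC' u M
  have hEnn : ∀ c, 0 ≤ E (fun g => Real.log (M g)) c := fun c =>
    Finset.sum_nonneg fun g _ => log_sub_mul_sub_nonneg (hMpos _) (hMpos _)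
  have hsumle : ∑ j, ∑ c ∈ C, E (fun g => Real.log (cosetAverage (H j) M g)) c
      ≤ K * ∑ c ∈ C, E (fun g => Real.log (M g)) c := by
    calc _ ≤ ∑ j, ∑ c ∈ C with c ∉ H j, E (fun g => Real.log (M g)) c :=
          Finset.sum_le_sum fun j _ => dirichlet_cosetAverage_le hC hC' (H j) hMpos
      _ = ∑ c ∈ C, ∑ j with c ∉ H j, E (fun g => Real.log (M g)) c :=
          Finset.sum_comm' (by simp [and_comm])
      _ ≤ ∑ c ∈ C, K * E (fun g => Real.log (M g)) c := by
          refine Finset.sum_le_sum fun c hc => ?_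
          rw [Finset.sum_const, nsmul_eq_mul]
          refine mul_le_mul_of_nonneg_right ?_ (hEnn c)
          have := hK c hc
          rw [Set.ncard_eq_toFinset_card'] at this
          simpa using this
      _ = _ := by rw [Finset.mul_sum]
  -- Stationarity gives `0 ≤ 2 * V ≤ -e * ∑ E`; this is where the slack `e > 0` is needed.
  have hzero : ∑ c ∈ C, E (fun g => Real.log (M g)) c ≤ 0 := by
    have h1 : 2 * V = -((K + e) * ∑ c ∈ C, E (fun g => Real.log (M g)) c)
        + ∑ j, ∑ c ∈ C, E (fun g => Real.log (cosetAverage (H j) M g)) c := by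
      have h2 := hparts fun g => Real.log (M g)
      have h3 : 2 * ∑ j, ∑ g, Real.log (cosetAverage (H j) M g) * D g
          = -∑ j, ∑ c ∈ C, E (fun g => Real.log (cosetAverage (H j) M g)) c := by
        rw [Finset.mul_sum, ← Finset.sum_neg_distrib]
        exact Finset.sum_congr rfl fun j _ => hparts _
      rw [hV, mul_sub, h3, mul_left_comm, h2]
      ring
    nlinarith
  have hconst : M = fun _ => 1 := by
    have h1 : ∀ g, M g = M 1 := eq_const_of_dirichlet_eq_zero hgen hMpos hzero
    have h2 := hM.2
    rw [Finset.sum_congr rfl fun g _ => h1 g, Finset.sum_const, nsmul_eq_mul,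
      Finset.card_univ] at h2
    have h3 : (Fintype.card G : ℝ) ≠ 0 := by exact_mod_cast Fintype.card_ne_zero
    funext g
    rw [h1 g]
    exact mul_left_cancel₀ h3 (h2.trans (mul_one _).symm)
  have hΦ1 : Φ M = 0 := by
    have h1 : ∀ j, cosetAverage (H j) M = fun _ => 1 := fun j => by
      funext g
      rw [hconst, cosetAverage_const]
    simp only [hΦ, h1]
    simp [hconst, sumMulLog]
  have := hmin (show F ∈ S from ⟨hF, hsum⟩)
  have h2 : Φ M ≤ Φ F := this
  rw [hΦ1] at h2
  exact sub_nonneg.1 h2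

/-- Subadditivity of entropy on a finite group: if `C` is a symmetric conjugation-invariant
generating set, each element of which lies outside at most `K` of the subgroups `H j`, then the
entropies of the averages of a density over the cosets of the `H j` add up to at most `K` times the
entropy of the density. -/
theorem sum_sumMulLog_cosetAverage_le {ι : Type*} [Fintype ι] {C : Finset G}
    (hC : ∀ g, ∀ c ∈ C, g * c * g⁻¹ ∈ C) (hC' : ∀ c ∈ C, c⁻¹ ∈ C)
    (hgen : Subgroup.closure (C : Set G) = ⊤) (H : ι → Subgroup G) (K : ℕ)
    (hK : ∀ c ∈ C, {j | c ∉ H j}.ncard ≤ K)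
    {F : G → ℝ} (hF : ∀ g, 0 ≤ F g) (hsum : ∑ g, F g = Fintype.card G) :
    ∑ j, sumMulLog (cosetAverage (H j) F) ≤ K * sumMulLog F := by
  -- Mixing with the constant density `1` gives the lower bound `t`; `t` also serves as the slack,
  -- and both disappear as `t → 0`.
  set A : ℝ → G → ℝ := fun t g => (1 - t) * F g + t with hA
  have hAc : Continuous A := by fun_prop
  have key : ∀ t ∈ Set.Ioo (0 : ℝ) 1,
      ∑ j, sumMulLog (cosetAverage (H j) (A t)) ≤ (K + t) * sumMulLog (A t) := by
    intro t ht
    refine sum_sumMulLog_cosetAverage_le_of_le hC hC' hgen H K hK ht.1 ht.1 (fun g => ?_) ?_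
    · exact le_add_of_nonneg_left (mul_nonneg (sub_nonneg.2 ht.2.le) (hF g))
    · simp only [hA]
      rw [Finset.sum_add_distrib, ← Finset.mul_sum, hsum, Finset.sum_const, nsmul_eq_mul,
        Finset.card_univ]
      ring
  have hA0 : A 0 = F := by simp [hA]
  have h1 : Continuous fun t => ∑ j, sumMulLog (cosetAverage (H j) (A t)) :=
    continuous_finsetSum _ fun j _ =>
      continuous_sumMulLog.comp ((continuous_cosetAverage (H j)).comp hAc)
  have h2 : Continuous fun t : ℝ => (K + t) * sumMulLog (A t) :=
    (continuous_const.add continuous_id).mul (continuous_sumMulLog.comp hAc)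
  have h3 := le_of_tendsto_of_tendsto (b := nhdsWithin (0 : ℝ) (Set.Ioi 0))
    ((h1.tendsto 0).mono_left nhdsWithin_le_nhds) ((h2.tendsto 0).mono_left nhdsWithin_le_nhds)
    (Filter.eventually_of_mem (Ioo_mem_nhdsGT one_pos) key)
  simpa [hA0] using h3

end GroupEntropy

/-! ### Kullback–Leibler divergences as finite sums -/

open MeasureTheory InformationTheory in
theorem klDiv_of_fintype {α : Type*} [Fintype α] [MeasurableSpace α] [MeasurableSingletonClass α]
    (μ ν : Measure α) [IsProbabilityMeasure μ] [IsProbabilityMeasure ν]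
    (h : ∀ a, ν.real {a} = 0 → μ.real {a} = 0) :
    klDiv μ ν ≠ ∞ ∧
      (klDiv μ ν).toReal = ∑ a, μ.real {a} * Real.log (μ.real {a} / ν.real {a}) := by
  have hac : μ ≪ ν := by
    intro s hs
    rw [← Set.biUnion_of_singleton s]
    refine (measure_biUnion_null_iff s.to_countable).2 fun a ha => ?_
    rw [← measureReal_eq_zero_iff]
    refine h a ?_
    rw [measureReal_eq_zero_iff]
    exact measure_mono_null (Set.singleton_subset_iff.2 ha) hs
  refine ⟨klDiv_ne_top hac .of_finite, ?_⟩
  rw [toReal_klDiv_of_measure_eq hac (by simp), integral_fintype .of_finite]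
  refine Finset.sum_congr rfl fun a _ => ?_
  by_cases ha : ν.real {a} = 0
  · simp [h a ha]
  · have h1 : μ {a} = μ.rnDeriv ν a * ν {a} := by
      conv_lhs => rw [← Measure.withDensity_rnDeriv_eq μ ν hac]
      rw [withDensity_apply _ (measurableSet_singleton a), lintegral_singleton]
    have h2 : μ.real {a} = (μ.rnDeriv ν a).toReal * ν.real {a} := by
      rw [measureReal_def, h1, ENNReal.toReal_mul, measureReal_def]
    rw [llr, smul_eq_mul]
    congr 2
    rw [h2, mul_div_cancel_right₀ _ ha]

/-- The two implications are absolute continuity, checked at the atoms `true` and `false`. -/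
theorem KLBernoulli_eq {p q : unitInterval} (h0 : (q : ℝ) = 0 → (p : ℝ) = 0)
    (h1 : (q : ℝ) = 1 → (p : ℝ) = 1) :
    KLBernoulli p q ≠ ∞ ∧ (KLBernoulli p q).toReal =
      (p : ℝ) * Real.log ((p : ℝ) / (q : ℝ)) +
        (1 - (p : ℝ)) * Real.log ((1 - (p : ℝ)) / (1 - (q : ℝ))) := by
  have ht : ∀ r : unitInterval,
      (ProbabilityTheory.bernoulliMeasure true false r).real {true} = r := fun r => by simp
  have hf : ∀ r : unitInterval,
      (ProbabilityTheory.bernoulliMeasure true false r).real {false} = 1 - r := fun r => by simp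
  have key := klDiv_of_fintype (ProbabilityTheory.bernoulliMeasure true false p)
    (ProbabilityTheory.bernoulliMeasure true false q) (by
      rintro (_ | _) h
      · rw [hf] at h ⊢
        linarith [h1 (by linarith)]
      · rw [ht] at h ⊢
        exact h0 h)
  simp only [Fintype.sum_bool, ht, hf] at key
  exact key

theorem KL_eq {α : Type*} [Fintype α] (P Q : PMF α) (hQ : ∀ a, Q a ≠ 0) :
    KL P Q ≠ ∞ ∧
      (KL P Q).toReal = ∑ a, (P a).toReal * Real.log ((P a).toReal / (Q a).toReal) := by
  let _ : MeasurableSpace α := ⊤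
  have hr : ∀ (R : PMF α) (a : α), R.toMeasure.real {a} = (R a).toReal := fun R a => by
    rw [MeasureTheory.measureReal_def, R.toMeasure_apply_singleton a trivial]
  have key := klDiv_of_fintype P.toMeasure Q.toMeasure fun a ha => by
    rw [hr] at ha
    exact absurd ha (ENNReal.toReal_ne_zero.2 ⟨hQ a, Q.apply_ne_top a⟩)
  simp only [hr] at key
  exact key

/-! ### Log-sum inequality and dependence on coordinates -/

/-- The log-sum inequality. -/
theorem sum_mul_log_div_le {ι : Type*} (s : Finset ι) {w x : ι → ℝ} (hw : ∀ i ∈ s, 0 ≤ w i)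
    (hx : ∀ i ∈ s, 0 ≤ x i) :
    (∑ i ∈ s, w i * x i) * Real.log ((∑ i ∈ s, w i * x i) / ∑ i ∈ s, w i)
      ≤ ∑ i ∈ s, w i * (x i * Real.log (x i)) := by
  rcases (Finset.sum_nonneg hw).eq_or_lt with h0 | hpos
  · have hz := (Finset.sum_eq_zero_iff_of_nonneg hw).1 h0.symm
    have hz' : ∀ y : ι → ℝ, ∑ i ∈ s, w i * y i = 0 := fun y =>
      Finset.sum_eq_zero fun i hi => by rw [hz i hi, zero_mul]
    rw [hz', hz', zero_mul]
  · have h := Real.convexOn_mul_log.map_centerMass_le hw hpos hx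
    simp only [Finset.centerMass, smul_eq_mul, Function.comp_apply] at h
    rw [inv_mul_eq_div, inv_mul_eq_div, div_mul_eq_mul_div, div_le_div_iff_of_pos_right hpos] at h
    exact h

/-- Pass from `x` to `y` one coordinate at a time: each change is either vacuous or at a coordinate
that `f` ignores. -/
theorem eq_of_forall_dependsOnCoord {ι X β : Type*} [Finite ι] {f : (ι → X) → β} {x y : ι → X}
    (h : ∀ i, DependsOnCoord f i → x i = y i) : f x = f y := by
  classical
  have := Fintype.ofFinite ι
  have key : ∀ s : Finset ι, f (fun i => if i ∈ s then y i else x i) = f x := by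
    intro s
    induction s using Finset.induction_on with
    | empty => simp
    | insert a s ha ih =>
      rw [← ih]
      by_cases hd : DependsOnCoord f a
      · congr 1
        funext i
        by_cases hi : i = a
        · subst hi
          simp [ha, h i hd]
        · simp [hi]
      · by_contra hne
        exact hd ⟨_, _, fun l hl => by simp [hl], hne⟩
  simpa using (key Finset.univ).symm

/-- Averaging `a ↦ a log a` against weights in `[0, 1]` and their complements. -/
theorem bernoulli_le_sum_sumMulLog {ι α : Type*} [Fintype ι] [Fintype α] {φ A : ι → α → ℝ}
    (h0 : ∀ j g, 0 ≤ φ j g) (h1 : ∀ j g, φ j g ≤ 1) (hA : ∀ j g, 0 ≤ A j g) :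
    (∑ j, ∑ g, φ j g * A j g) *
        Real.log ((∑ j, ∑ g, φ j g * A j g) / ∑ j, ∑ g, φ j g) +
      (∑ j, ∑ g, (1 - φ j g) * A j g) *
        Real.log ((∑ j, ∑ g, (1 - φ j g) * A j g) / ∑ j, ∑ g, (1 - φ j g))
      ≤ ∑ j, sumMulLog (A j) := by
  have e1 := sum_mul_log_div_le (Finset.univ : Finset (ι × α)) (w := fun i => φ i.1 i.2)
    (x := fun i => A i.1 i.2) (fun i _ => h0 _ _) (fun i _ => hA _ _)
  have e2 := sum_mul_log_div_le (Finset.univ : Finset (ι × α)) (w := fun i => 1 - φ i.1 i.2)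
    (x := fun i => A i.1 i.2) (fun i _ => sub_nonneg.2 (h1 _ _)) (fun i _ => hA _ _)
  simp only [Fintype.sum_prod_type] at e1 e2
  refine (add_le_add e1 e2).trans_eq ?_
  simp only [sumMulLog, ← Finset.sum_add_distrib]
  exact Finset.sum_congr rfl fun j _ => Finset.sum_congr rfl fun g _ => by ring

/-! ### Shearer's inequality on the symmetric group -/

/-- The permutation version of Shearer's inequality, with its loss of a factor `2`. -/
theorem sum_sumMulLog_cosetAverage_fixingSubgroup_le {ι κ : Type*} [Fintype ι] [DecidableEq ι]
    [Fintype κ] (S : κ → Set ι) (k : ℕ) (hS : ∀ i, {j | i ∈ S j}.ncard ≤ k)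
    {F : Equiv.Perm ι → ℝ} (hF : ∀ g, 0 ≤ F g) (hsum : ∑ g, F g = Fintype.card (Equiv.Perm ι)) :
    ∑ j, sumMulLog (cosetAverage (fixingSubgroup (Equiv.Perm ι) (S j)) F)
      ≤ 2 * k * sumMulLog F := by
  classical
  have hmain := sum_sumMulLog_cosetAverage_le
    (C := Finset.univ.filter fun σ : Equiv.Perm ι => σ.IsSwap) ?_ ?_ ?_
    (fun j => fixingSubgroup (Equiv.Perm ι) (S j)) (2 * k) ?_ hF hsum
  · exact_mod_cast hmain
  · intro g c hc
    obtain ⟨a, b, hab, rfl⟩ := (Finset.mem_filter.1 hc).2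
    refine Finset.mem_filter.2 ⟨Finset.mem_univ _, g a, g b, g.injective.ne hab, ?_⟩
    rw [Equiv.swap_apply_apply]
  · intro c hc
    obtain ⟨a, b, hab, rfl⟩ := (Finset.mem_filter.1 hc).2
    simpa using hc
  · simpa using Equiv.Perm.closure_isSwap (α := ι)
  · intro c hc
    obtain ⟨a, b, hab, rfl⟩ := (Finset.mem_filter.1 hc).2
    have hsub : {j | Equiv.swap a b ∉ fixingSubgroup (Equiv.Perm ι) (S j)}
        ⊆ {j | a ∈ S j} ∪ {j | b ∈ S j} := by
      intro j hj
      by_contra hn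
      simp only [Set.mem_union, Set.mem_ofPred_eq, not_or] at hn
      refine hj ((mem_fixingSubgroup_iff _).2 fun i hi => ?_)
      exact Equiv.swap_apply_of_ne_of_ne (fun h => hn.1 (h ▸ hi)) (fun h => hn.2 (h ▸ hi))
    calc _ ≤ _ := Set.ncard_le_ncard hsub
      _ ≤ _ := Set.ncard_union_le _ _
      _ ≤ 2 * k := by linarith [hS a, hS b]

/-! ### Degenerate parameters and the transfer to bijections -/

/-- As `Q` charges every bijection, a zero average of nonnegative functions forces each `f j` to
vanish on all bijections. -/
theorem avgExpect_eq_zero {N m : ℕ} {X : Type*} [Fintype X] [DecidableEq X]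
    {P Q : PMF (Fin N ≃ X)} (hQ : ∀ σ, Q σ ≠ 0) (f : Fin m → (Fin N → X) → unitInterval)
    (h : (avgExpect Q f : ℝ) = 0) : (avgExpect P f : ℝ) = 0 := by
  rcases Nat.eq_zero_or_pos m with rfl | hm
  · simp [avgExpect]
  have hm' : (1 / (m : ℝ)) ≠ 0 := by positivity
  have h1 : ∑ j, expect Q (f j) = 0 := (mul_eq_zero.1 h).resolve_left hm'
  have h2 := (Finset.sum_eq_zero_iff_of_nonneg fun j _ => (expect_mem Q (f j)).1).1 h1
  change (1 / (m : ℝ)) * ∑ j, expect P (f j) = 0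
  rw [Finset.sum_eq_zero, mul_zero]
  intro j hj
  have h3 := (Finset.sum_eq_zero_iff_of_nonneg fun σ _ =>
    mul_nonneg ENNReal.toReal_nonneg (f j fun i => σ i).2.1).1 (h2 j hj)
  refine Finset.sum_eq_zero fun σ hσ => ?_
  rw [(mul_eq_zero.1 (h3 σ hσ)).resolve_left
    (ENNReal.toReal_ne_zero.2 ⟨hQ σ, Q.apply_ne_top σ⟩), mul_zero]

theorem expect_symm {N : ℕ} {X : Type*} [Fintype X] [DecidableEq X]
    (P : PMF (Fin N ≃ X)) (g : (Fin N → X) → unitInterval) :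
    expect P (fun x => unitInterval.symm (g x)) = 1 - expect P g := by
  rw [← sum_toReal_pmf P, expect, expect, ← Finset.sum_sub_distrib]
  exact Finset.sum_congr rfl fun σ _ => by rw [unitInterval.coe_symm_eq]; ring

theorem avgExpect_symm {N m : ℕ} (hm : m ≠ 0) {X : Type*} [Fintype X] [DecidableEq X]
    (P : PMF (Fin N ≃ X)) (f : Fin m → (Fin N → X) → unitInterval) :
    (avgExpect P (fun j x => unitInterval.symm (f j x)) : ℝ) = 1 - avgExpect P f := by
  change (1 / (m : ℝ)) * ∑ j, expect P (fun x => unitInterval.symm (f j x))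
    = 1 - (1 / (m : ℝ)) * ∑ j, expect P (f j)
  have : (m : ℝ) ≠ 0 := by exact_mod_cast hm
  simp only [expect_symm, Finset.sum_sub_distrib]
  simp
  field_simp

theorem uniformBijection_apply {N : ℕ} {X : Type*} [Fintype X] [DecidableEq X]
    (hX : Fintype.card X = N) (σ : Fin N ≃ X) :
    uniformBijection hX σ = (Fintype.card (Fin N ≃ X) : ℝ≥0∞)⁻¹ := by
  have : Nonempty (Fin N ≃ X) := nonempty_bijections hX
  exact PMF.uniformOfFintype_apply σ

theorem uniformBijection_ne_zero {N : ℕ} {X : Type*} [Fintype X] [DecidableEq X]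
    (hX : Fintype.card X = N) (σ : Fin N ≃ X) : uniformBijection hX σ ≠ 0 := by
  simp [uniformBijection_apply]

theorem mul_bernoulli_le {N m k : ℕ} (hm : m ≠ 0) {X : Type*} [Fintype X] [DecidableEq X]
    (hX : Fintype.card X = N) (P : PMF (Fin N ≃ X))
    (f : Fin m → (Fin N → X) → unitInterval) (hf : IsReadK k f) {p q : ℝ}
    (hp : p = avgExpect P f) (hq : q = avgExpect (uniformBijection hX) f) :
    m * (p * Real.log (p / q) + (1 - p) * Real.log ((1 - p) / (1 - q)))
      ≤ 2 * k * (KL P (uniformBijection hX)).toReal := by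
  obtain ⟨e⟩ := nonempty_bijections hX
  set Φ : Equiv.Perm (Fin N) ≃ (Fin N ≃ X) := Equiv.equivCongr (Equiv.refl _) e with hΦ
  set n : ℝ := (Fintype.card (Equiv.Perm (Fin N)) : ℝ) with hn
  have hn0 : 0 < n := by rw [hn]; exact_mod_cast Fintype.card_pos
  have hm0 : (m : ℝ) ≠ 0 := by exact_mod_cast hm
  have hcard : (Fintype.card (Fin N ≃ X) : ℝ) = n := by rw [hn, Fintype.card_congr Φ]
  have hQ : ∀ σ, (uniformBijection hX σ).toReal = n⁻¹ := fun σ => by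
    rw [uniformBijection_apply, ENNReal.toReal_inv, ENNReal.toReal_natCast, hcard]
  set F : Equiv.Perm (Fin N) → ℝ := fun g => n * (P (Φ g)).toReal with hFdef
  have hF : ∀ g, 0 ≤ F g := fun g => mul_nonneg hn0.le ENNReal.toReal_nonneg
  have hsum : ∑ g, F g = n := by
    rw [← Finset.mul_sum, Equiv.sum_comp Φ fun σ => (P σ).toReal, sum_toReal_pmf, mul_one]
  set φ : Fin m → Equiv.Perm (Fin N) → ℝ := fun j g => f j fun i => Φ g i with hφ
  set S : Fin m → Set (Fin N) := fun j => {i | DependsOnCoord (f j) i} with hS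
  set A : Fin m → Equiv.Perm (Fin N) → ℝ := fun j =>
    cosetAverage (fixingSubgroup (Equiv.Perm (Fin N)) (S j)) F with hA
  -- Right multiplication by `h` precomposes with `h`, which leaves the entries at the coordinates
  -- in `S j` unchanged.
  have hφinv : ∀ j g, ∀ h ∈ fixingSubgroup (Equiv.Perm (Fin N)) (S j),
      φ j (g * h) = φ j g := by
    intro j g h hh
    have : f j (fun i => Φ (g * h) i) = f j fun i => Φ g i :=
      eq_of_forall_dependsOnCoord fun i hi => by
        have := (mem_fixingSubgroup_iff _).1 hh i hi
        rw [Equiv.Perm.smul_def] at this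
        simp [hΦ, this]
    simp only [hφ, this]
  have hmain : ∑ j, sumMulLog (A j) ≤ 2 * k * sumMulLog F :=
    sum_sumMulLog_cosetAverage_fixingSubgroup_le S k hf hF hsum
  have hkl : n * (KL P (uniformBijection hX)).toReal = sumMulLog F := by
    rw [(KL_eq P _ (uniformBijection_ne_zero hX)).2, ← Equiv.sum_comp Φ, Finset.mul_sum]
    refine Finset.sum_congr rfl fun g _ => ?_
    rw [hQ, div_inv_eq_mul, mul_comm (P _).toReal n, ← mul_assoc]
  have hsA : ∀ j, ∑ g, A j g = n := fun j => (sum_cosetAverage _ F).trans hsum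
  have hφA : ∑ j, ∑ g, φ j g * A j g = n * m * p := by
    have h1 : ∀ j, ∑ g, φ j g * A j g = n * expect P (f j) := fun j => by
      rw [Finset.sum_congr rfl fun g _ => mul_comm _ _, sum_cosetAverage_mul _ F _ (hφinv j),
        expect, ← Equiv.sum_comp Φ, Finset.mul_sum]
      exact Finset.sum_congr rfl fun g _ => mul_assoc _ _ _
    rw [Finset.sum_congr rfl fun j _ => h1 j, ← Finset.mul_sum, hp]
    change _ = n * m * ((1 / (m : ℝ)) * _)
    field_simp
  have hφs : ∑ j, ∑ g, φ j g = n * m * q := by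
    have h1 : ∀ j, ∑ g, φ j g = n * expect (uniformBijection hX) (f j) := fun j => by
      rw [expect, ← Equiv.sum_comp Φ, Finset.mul_sum]
      refine Finset.sum_congr rfl fun g _ => ?_
      rw [hQ, mul_inv_cancel_left₀ hn0.ne']
    rw [Finset.sum_congr rfl fun j _ => h1 j, ← Finset.mul_sum, hq]
    change _ = n * m * ((1 / (m : ℝ)) * _)
    field_simp
  have hφA' : ∑ j, ∑ g, (1 - φ j g) * A j g = n * m * (1 - p) := by
    simp only [sub_mul, one_mul, Finset.sum_sub_distrib, hφA, hsA]
    simp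
    ring
  have hφs' : ∑ j, ∑ g, (1 - φ j g) = n * m * (1 - q) := by
    simp only [Finset.sum_sub_distrib, hφs]
    simp [hn, Fintype.card_perm]
    ring
  have hb := bernoulli_le_sum_sumMulLog (φ := φ) (A := A) (fun j g => (f j _).2.1)
    (fun j g => (f j _).2.2) (fun j g => le_cosetAverage _ hF g)
  rw [hφA, hφs, hφA', hφs', mul_div_mul_left _ _ (mul_ne_zero hn0.ne' hm0),
    mul_div_mul_left _ _ (mul_ne_zero hn0.ne' hm0)] at hb
  rw [← hkl] at hmain
  refine le_of_mul_le_mul_left ?_ hn0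
  linarith

end ReadKBijections

theorem theorem6 {N m k : ℕ} {X : Type*} [Fintype X] [DecidableEq X]
    (hX : Fintype.card X = N) (P Q : PMF (Fin N ≃ X))
    (hQ : Q = ReadKBijections.uniformBijection hX)
    (f : Fin m → (Fin N → X) → unitInterval) (hf : ReadKBijections.IsReadK k f)
    (p q : unitInterval) (hp : p = ReadKBijections.avgExpect P f)
    (hq : q = ReadKBijections.avgExpect Q f) :
    (m : ℝ≥0∞) * ReadKBijections.KLBernoulli p q ≤ 2 * (k : ℝ≥0∞) * ReadKBijections.KL P Q ∧
      ReadKBijections.KLBernoulli p q ≠ ∞ ∧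
      (ReadKBijections.KLBernoulli p q).toReal =
        (p : ℝ) * Real.log ((p : ℝ) / (q : ℝ)) +
          (1 - (p : ℝ)) * Real.log ((1 - (p : ℝ)) / (1 - (q : ℝ))) := by
  subst hQ
  have hQ0 := ReadKBijections.uniformBijection_ne_zero hX
  have h0 : (q : ℝ) = 0 → (p : ℝ) = 0 := fun h => by
    rw [hp]
    exact ReadKBijections.avgExpect_eq_zero hQ0 f (hq ▸ h)
  have h1 : (q : ℝ) = 1 → (p : ℝ) = 1 := fun h => by
    -- For `m = 0` the convention `1 / 0 = 0` gives `q = 0`, not `1`.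
    have hm : m ≠ 0 := by
      rintro rfl
      rw [hq] at h
      simp [ReadKBijections.avgExpect] at h
    -- Replacing each `f j` by `1 - f j` reduces `q = 1` to the case of a zero average.
    have h2 := ReadKBijections.avgExpect_eq_zero (P := P) hQ0
      (fun j x => unitInterval.symm (f j x))
      (by rw [ReadKBijections.avgExpect_symm hm, ← hq, h, sub_self])
    rw [ReadKBijections.avgExpect_symm hm, ← hp] at h2
    linarith
  obtain ⟨hfin, hval⟩ := ReadKBijections.KLBernoulli_eq h0 h1
  refine ⟨?_, hfin, hval⟩
  rcases eq_or_ne m 0 with rfl | hm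
  · simp
  have hKL := (ReadKBijections.KL_eq P _ hQ0).1
  rw [← ENNReal.toReal_le_toReal (ENNReal.mul_ne_top (by simp) hfin)
    (ENNReal.mul_ne_top (by finiteness) hKL)]
  simp only [ENNReal.toReal_mul, ENNReal.toReal_natCast, ENNReal.toReal_ofNat, hval]
  exact ReadKBijections.mul_bernoulli_le hm hX P f hf (by rw [hp]) (by rw [hq])
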